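/- A geometric graph is a finite simple graph drawn in the plane with straight-line edges, where the vertices are distinct points, no three of them collinear, and the drawing is noncrossing (two distinct edges share no point other than a common end vertex). A compatible matching of a geometric graph $G$ is a matching $M$ on the vertex set of $G$, with straight-line edges, such that $M$ contains no edge of $G$ and $G+M$ is noncrossing; it is maximal if it is not properly contained in another compatible matching of $G$. Its size is its number of edges. (a) For all integers $n, m$ with $n\ge 5$, $\frac{7n+95}{10}\le m\le 2n+2$ and $m\le 3n-7$, there is a geometric graph with $n$ vertices and $m$ edges that has a maximal compatible matching of size $\left\lceil\frac{2n-m+3}{13}\right\rceil$. (The condition $m\le 3n-7$ only excludes the pairs $(n,m)=(6,14),(7,15),(7,16),(8,18)$.) (b) Let $\mathrm{mm}(G)$ be the minimum size of a maximal compatible matching of $G$, and let $$\mathrm{mm}(d)=\liminf_{n\to\infty}\ \min\{\mathrm{mm}(G)/n \mid G \text{ a geometric graph with } n \text{ vertices and at most } dn \text{ edges}\}.$$ Then $\mathrm{mm}(d)\le \frac{2-d}{13}$ for every real $d$ with $\frac{7}{10}<d<2$. -/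

import Mathlib

open Filter

/-- A straight-line drawing of the graph `H`, with vertex `v` placed at the point `p v` of the
plane, is noncrossing if two distinct edges share no point other than a common end vertex. -/
def IsNoncrossing {V : Type*} (H : SimpleGraph V) (p : V → ℝ × ℝ) : Prop :=
  ∀ a b c d : V, H.Adj a b → H.Adj c d → s(a, b) ≠ s(c, d) →
    segment ℝ (p a) (p b) ∩ segment ℝ (p c) (p d) ⊆ p '' ({a, b} ∩ {c, d})

/-- A (noncrossing) geometric graph: a graph drawn in the plane with straight-line edges,
without crossings, whose vertices are in general position. (The plane is `ℝ × ℝ`; only its affine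
structure is used.) -/
structure GeometricGraph (V : Type*) where
  graph : SimpleGraph V
  pos : V → ℝ × ℝ
  pos_injective : Function.Injective pos
  general_position : ∀ u v w : V, u ≠ v → u ≠ w → v ≠ w →
    ¬ Collinear ℝ {pos u, pos v, pos w}
  noncrossing : IsNoncrossing graph pos

namespace GeometricGraph

variable {V : Type*}

/-- The number of edges. -/
noncomputable def numEdges (G : GeometricGraph V) : ℕ := G.graph.edgeSet.ncard

/-- `M` is a matching on the vertices of `G` (every vertex has at most one `M`-neighbour; a
matching is represented by the graph formed by its edges) that uses no edge of `G` and such that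
no two edges cross in `G + M`, drawn with straight-line edges. -/
structure IsCompatibleMatching (G : GeometricGraph V) (M : SimpleGraph V) : Prop where
  matching : ∀ a b c : V, M.Adj a b → M.Adj a c → b = c
  disjoint : Disjoint G.graph M
  noncrossing : IsNoncrossing (G.graph ⊔ M) G.pos

/-- A compatible matching that is contained in no other compatible matching. -/
def IsMaximalCompatibleMatching (G : GeometricGraph V) (M : SimpleGraph V) : Prop :=
  Maximal G.IsCompatibleMatching M

/-- A finite geometric graph has a maximal compatible matching, so that `mm` below is the minimum
of a nonempty set of natural numbers. -/
theorem exists_isMaximalCompatibleMatching [Finite V] (G : GeometricGraph V) :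
    ∃ M : SimpleGraph V, G.IsMaximalCompatibleMatching M := by
  have h : G.IsCompatibleMatching ⊥ :=
    ⟨fun _ _ _ h => h.elim, disjoint_bot_right, by simpa using G.noncrossing⟩
  obtain ⟨M, -, hM⟩ := (Set.toFinite {M | G.IsCompatibleMatching M}).exists_le_maximal h
  exact ⟨M, hM⟩

/-- `mm(G)`, the smallest size of a maximal compatible matching of `G`. -/
noncomputable def mm (G : GeometricGraph V) : ℕ :=
  sInf {k : ℕ | ∃ M : SimpleGraph V, G.IsMaximalCompatibleMatching M ∧ M.edgeSet.ncard = k}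

/-- The family of all geometric graphs with `n` vertices and at most `d n` edges. -/
def family (d : ℝ) (n : ℕ) : Set (GeometricGraph (Fin n)) :=
  {G | (G.numEdges : ℝ) ≤ d * n}

/-- `mm(d) = liminf_{n → ∞} min {mm(G) / n | G ∈ family d n}`. The infimum and the limit inferior
are taken in the complete lattice of extended reals. -/
noncomputable def mmDensity (d : ℝ) : EReal :=
  liminf (fun n : ℕ => ⨅ G ∈ family d n, (((G.mm : ℝ) / n : ℝ) : EReal)) atTop

end GeometricGraph

/-!
Take a plane graph with edge set `T`, a set `H ⊆ T` of frame edges, and a set of free points, any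
two of which are joined by an edge of `H` or by a segment that crosses one. If `M ⊆ H` is a perfect
matching of the points that are not free, a compatible matching extending `M` can only add edges
between free points, which is impossible as long as `H` is present. So `M` is maximal for every
graph between `H \ M` and `T \ M`, and the number of edges can be chosen freely between `|H| - |M|`
and `|T| - |M|`.

Points are added one at a time, most of them just beyond the midpoint of an edge. To enlarge `M`,
add a point `z` beyond a hull edge `p q` with matched ends, joined to `p` and `q` in the frame, and
near each of `p q` and `p z` two adjacent free points, which that edge separates from all other free
points. Do the same with a point `y` beyond `z q`, and match `y` with `z`. One more matching edge
thus costs ten points, eight frame edges and sixteen edges, so that the smallest possible number of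
edges satisfies `m = 2 n - 13 k + O(1)`. Matchings of size one are also found in maximal plane
graphs, which have between `2 n - 3` and `3 n - 6` edges.
-/

open Topology

section Orientation

variable {a b c : ℝ × ℝ} {s t : ℝ}

/-- Twice the signed area of the triangle `a b c`: positive when `c` lies to the left of the
directed line `a b`, zero when the three points are collinear. -/
def orient (a b c : ℝ × ℝ) : ℝ :=
  (b.1 - a.1) * (c.2 - a.2) - (b.2 - a.2) * (c.1 - a.1)

theorem orient_rotate (a b c : ℝ × ℝ) : orient b c a = orient a b c := by
  unfold orient; ring

theorem orient_swap_left (a b c : ℝ × ℝ) : orient b a c = -orient a b c := by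
  unfold orient; ring

theorem orient_swap_right (a b c : ℝ × ℝ) : orient a c b = -orient a b c := by
  unfold orient; ring

@[simp] theorem orient_self_left (a b : ℝ × ℝ) : orient a b a = 0 := by
  unfold orient; ring

@[simp] theorem orient_self_right (a b : ℝ × ℝ) : orient a b b = 0 := by
  unfold orient; ring

theorem orient_combo (a b c d : ℝ × ℝ) (hst : s + t = 1) :
    orient a b (s • c + t • d) = s * orient a b c + t * orient a b d := by
  obtain rfl : s = 1 - t := by linarith
  simp only [orient, Prod.fst_add, Prod.snd_add, Prod.smul_fst, Prod.smul_snd, smul_eq_mul]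
  ring

theorem orient_lineMap (a b c d : ℝ × ℝ) (t : ℝ) :
    orient a b (AffineMap.lineMap c d t) = (1 - t) * orient a b c + t * orient a b d := by
  rw [AffineMap.lineMap_apply_module, orient_combo _ _ _ _ (sub_add_cancel 1 t)]

theorem orient_midpoint (a b c d : ℝ × ℝ) :
    orient a b (midpoint ℝ c d) = (orient a b c + orient a b d) / 2 := by
  rw [midpoint, orient_lineMap, invOf_eq_inv]
  ring

theorem convexOn_orient (a b : ℝ × ℝ) : ConvexOn ℝ Set.univ (orient a b) :=
  ⟨convex_univ, fun _ _ _ _ _ _ _ _ hst => (orient_combo _ _ _ _ hst).le⟩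

theorem concaveOn_orient (a b : ℝ × ℝ) : ConcaveOn ℝ Set.univ (orient a b) :=
  ⟨convex_univ, fun _ _ _ _ _ _ _ _ hst => (orient_combo _ _ _ _ hst).ge⟩

@[fun_prop] theorem continuous_orient {X : Type*} [TopologicalSpace X] {f g h : X → ℝ × ℝ}
    (hf : Continuous f) (hg : Continuous g) (hh : Continuous h) :
    Continuous fun x => orient (f x) (g x) (h x) := by
  unfold orient; fun_prop

theorem not_collinear_of_orient_ne_zero (h : orient a b c ≠ 0) : ¬ Collinear ℝ {a, b, c} := by
  intro hc
  obtain ⟨v, hv⟩ := (collinear_iff_of_mem (k := ℝ) (p₀ := a) (by simp)).1 hc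
  obtain ⟨r, rfl⟩ := hv b (by simp)
  obtain ⟨t, rfl⟩ := hv c (by simp)
  apply h
  simp only [orient, vadd_eq_add, Prod.fst_add, Prod.snd_add, Prod.smul_fst, Prod.smul_snd,
    smul_eq_mul]
  ring

theorem exists_orient_neg (h : a ≠ b) : ∃ w, orient a b w < 0 := by
  refine ⟨(a.1 + (b.2 - a.2), a.2 - (b.1 - a.1)), ?_⟩
  have hsq : 0 < (b.1 - a.1) ^ 2 + (b.2 - a.2) ^ 2 := by
    contrapose! h
    ext <;> nlinarith [sq_nonneg (b.1 - a.1), sq_nonneg (b.2 - a.2)]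
  unfold orient
  linarith

end Orientation

section Segments

variable {a b c d p q v w : ℝ × ℝ}

theorem disjoint_segment_of_separated {E : Type*} [AddCommGroup E] [Module ℝ E] {f : E → ℝ}
    (hf : ConvexOn ℝ Set.univ f) (hf' : ConcaveOn ℝ Set.univ f) {a b c d : E}
    (ha : f a ≤ 0) (hb : f b ≤ 0) (hc : 0 < f c) (hd : 0 < f d) :
    Disjoint (segment ℝ a b) (segment ℝ c d) := by
  have hab := (hf.convex_le 0).segment_subset ⟨trivial, ha⟩ ⟨trivial, hb⟩
  have hcd := (hf'.convex_gt 0).segment_subset ⟨trivial, hc⟩ ⟨trivial, hd⟩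
  exact Set.disjoint_left.2 fun x hx hx' => (hab hx).2.not_gt (hcd hx').2

theorem disjoint_segment_of_orient_pos (ha : orient p q a ≤ 0) (hb : orient p q b ≤ 0)
    (hc : 0 < orient p q c) (hd : 0 < orient p q d) :
    Disjoint (segment ℝ a b) (segment ℝ c d) :=
  disjoint_segment_of_separated (convexOn_orient p q) (concaveOn_orient p q) ha hb hc hd

theorem segment_inter_segment_subset (h : orient a b c ≠ 0) :
    segment ℝ a b ∩ segment ℝ a c ⊆ {a} := by
  rintro _ ⟨⟨s, t, -, -, hst, rfl⟩, ⟨s', t', -, -, hst', hx⟩⟩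
  obtain rfl : t' = 0 := by
    have := congrArg (orient a b) hx
    rw [orient_combo _ _ _ _ hst, orient_combo _ _ _ _ hst'] at this
    simpa [h] using this
  obtain rfl : s' = 1 := by linarith
  simpa using hx.symm

theorem segment_inter_segment_nonempty (hv : orient p q v < 0) (hw : 0 < orient p q w)
    (hp : 0 < orient p v w) (hq : 0 < orient v q w) :
    (segment ℝ v w ∩ segment ℝ p q).Nonempty := by
  -- Twice the area of the quadrilateral `p v q w`, cut along either diagonal.
  set D := orient p q w - orient p q v with hD
  have hD' : D = orient p v w + orient v q w := by rw [hD]; unfold orient; ring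
  have hD0 : 0 < D := by linarith
  refine ⟨(orient p q w / D) • v + (-orient p q v / D) • w,
    ⟨_, _, by positivity, div_nonneg (by linarith) hD0.le, by field_simp; linarith, rfl⟩,
    ⟨orient v q w / D, orient p v w / D, by positivity, by positivity,
      by field_simp; linarith, ?_⟩⟩
  ext <;> simp only [Prod.fst_add, Prod.smul_fst, Prod.snd_add, Prod.smul_snd, smul_eq_mul] <;>
    field_simp <;> unfold orient <;> ring

theorem disjoint_segment_midpoint (h : orient a b c ≠ 0) :
    Disjoint (segment ℝ (midpoint ℝ c a) c) (segment ℝ a b) := by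
  rcases h.lt_or_gt with h | h
  · refine (disjoint_segment_of_orient_pos (p := b) (q := a) (by simp) (by simp) ?_ ?_).symm
    · rw [orient_midpoint, orient_self_right, orient_swap_left]; linarith
    · rw [orient_swap_left]; linarith
  · refine (disjoint_segment_of_orient_pos (p := a) (q := b) (by simp) (by simp) ?_ h).symm
    rw [orient_midpoint, orient_self_left]; linarith

theorem eventually_disjoint_segment {E : Type*} [AddCommGroup E] [Module ℝ E] [TopologicalSpace E]
    [IsTopologicalAddGroup E] [ContinuousSMul ℝ E] {K : Set E} (hK : IsClosed K) {a b : E}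
    (h : Disjoint (segment ℝ a b) K) :
    ∀ᶠ x : E × E in 𝓝 (a, b), Disjoint (segment ℝ x.1 x.2) K := by
  have hcompact : ∀ᶠ x : E × E in 𝓝 (a, b), ∀ t ∈ Set.Icc (0 : ℝ) 1,
      AffineMap.lineMap x.1 x.2 t ∈ Kᶜ := by
    refine isCompact_Icc.eventually_forall_of_forall_eventually fun t ht => ?_
    have hcont : Continuous fun z : (E × E) × ℝ => AffineMap.lineMap z.1.1 z.1.2 z.2 := by
      simp only [AffineMap.lineMap_apply_module]; fun_prop
    refine hcont.continuousAt.eventually (hK.isOpen_compl.mem_nhds ?_)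
    exact Set.disjoint_left.1 h (segment_eq_image_lineMap ℝ a b ▸ Set.mem_image_of_mem _ ht)
  filter_upwards [hcompact] with x hx
  rw [segment_eq_image_lineMap, Set.disjoint_left]
  rintro _ ⟨t, ht, rfl⟩
  exact hx t ht

theorem isClosed_segment {E : Type*} [AddCommGroup E] [Module ℝ E] [TopologicalSpace E]
    [IsTopologicalAddGroup E] [ContinuousSMul ℝ E] [T2Space E] (a b : E) :
    IsClosed (segment ℝ a b) := by
  rw [← convexHull_pair (𝕜 := ℝ)]
  exact (Set.toFinite {a, b}).isClosed_convexHull ℝ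

end Segments

section GenericPoints

variable {S : Finset (ℝ × ℝ)} {a b p q v v₀ w : ℝ × ℝ} {Q : ℝ × ℝ → Prop}

theorem isOpen_orient_neg (a b : ℝ × ℝ) : IsOpen {v | orient a b v < 0} :=
  isOpen_lt (by fun_prop) continuous_const

theorem eventually_midpoint_orient_pos (h : 0 < orient a b v + orient a b w) :
    ∀ᶠ x in 𝓝 (midpoint ℝ v w), 0 < orient a b x :=
  (show Continuous (orient a b) by fun_prop).continuousAt.eventually
    (lt_mem_nhds (by simpa only [orient_midpoint] using half_pos h))

theorem eventually_forall_mem_pos {X Y : Type*} [TopologicalSpace X] {f : X → Y → ℝ}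
    (hf : ∀ w, Continuous fun x => f x w) (S : Finset Y) (x₀ : X) :
    ∀ᶠ x in 𝓝 x₀, ∀ w ∈ S, 0 < f x₀ w → 0 < f x w := by
  simp only [eventually_all_finset, eventually_imp_distrib_left]
  exact fun w _ hw => (hf w).continuousAt.eventually (lt_mem_nhds hw)

theorem mem_closure_of_forall_lineMap_mem {E : Type*} [AddCommGroup E] [Module ℝ E]
    [TopologicalSpace E] [IsTopologicalAddGroup E] [ContinuousSMul ℝ E] {U : Set E} {v w : E}
    (h : ∀ t : ℝ, 0 < t → AffineMap.lineMap v w t ∈ U) : v ∈ closure U := by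
  have htendsto : Tendsto (AffineMap.lineMap v w : ℝ → E) (𝓝[>] 0) (𝓝 v) := by
    have := (AffineMap.lineMap_continuous (p := v) (q := w) (R := ℝ)).tendsto 0
    simpa using this.mono_left nhdsWithin_le_nhds
  exact mem_closure_of_tendsto htendsto (eventually_mem_nhdsWithin.mono h)

theorem mem_closure_orient_neg (hab : a ≠ b) (hv : orient a b v = 0) :
    v ∈ closure {w | orient a b w < 0} := by
  obtain ⟨w, hw⟩ := exists_orient_neg hab
  refine mem_closure_of_forall_lineMap_mem (w := w) fun t ht => ?_
  simpa [orient_lineMap, hv] using mul_neg_of_pos_of_neg ht hw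

theorem dense_orient_ne_zero (hab : a ≠ b) : Dense {v | orient a b v ≠ 0} := by
  intro v
  by_cases hv : orient a b v = 0
  · exact closure_mono (fun _ => ne_of_lt) (mem_closure_orient_neg hab hv)
  · exact subset_closure hv

/-- The point `v` lies on no line spanned by two points of `S`. -/
def IsGeneric (S : Finset (ℝ × ℝ)) (v : ℝ × ℝ) : Prop :=
  ∀ a ∈ S, ∀ b ∈ S, a ≠ b → orient a b v ≠ 0

theorem IsGeneric.notMem (h : IsGeneric S v) (hS : S.Nontrivial) : v ∉ S := by
  intro hv
  obtain ⟨b, hb, hbv⟩ := hS.exists_ne v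
  exact h v hv b hb hbv.symm (orient_self_left v b)

theorem dense_isGeneric (S : Finset (ℝ × ℝ)) : Dense {v | IsGeneric S v} := by
  have hdense : Dense (⋂ e ∈ (S.offDiag : Set ((ℝ × ℝ) × (ℝ × ℝ))), {v | orient e.1 e.2 v ≠ 0}) :=
    dense_biInter_of_isOpen
      (fun e _ => isOpen_ne_fun (by fun_prop) continuous_const)
      S.offDiag.countable_toSet
      (fun e he => dense_orient_ne_zero (Finset.mem_offDiag.1 he).2.2)
  refine hdense.mono fun v hv a ha b hb hab => ?_
  exact Set.mem_iInter₂.1 hv (a, b) (Finset.mem_offDiag.2 ⟨ha, hb, hab⟩)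

theorem exists_isGeneric (S : Finset (ℝ × ℝ)) {U : Set (ℝ × ℝ)} (hU : IsOpen U)
    (hv₀ : v₀ ∈ closure U) (hQ : ∀ᶠ v in 𝓝 v₀, Q v) : ∃ v ∈ U, Q v ∧ IsGeneric S v := by
  obtain ⟨O, hOQ, hO, hvO⟩ := eventually_nhds_iff.1 hQ
  obtain ⟨v, ⟨hvO, hvU⟩, hv⟩ := (dense_isGeneric S).inter_open_nonempty _ (hO.inter hU)
    (mem_closure_iff.1 hv₀ O hO hvO)
  exact ⟨v, hvU, hOQ v hvO, hv⟩

/-- The generic point `v` lies to the right of `p q`, so close to the segment that it is separated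
by this segment from every point of `S` to the left of `p q`. -/
structure IsBeyond (S : Finset (ℝ × ℝ)) (p q v : ℝ × ℝ) : Prop where
  generic : IsGeneric S v
  orient_neg : orient p q v < 0
  orient_left_pos : ∀ w ∈ S, 0 < orient p q w → 0 < orient p v w
  orient_right_pos : ∀ w ∈ S, 0 < orient p q w → 0 < orient v q w

theorem exists_isBeyond (S : Finset (ℝ × ℝ)) (hpq : p ≠ q)
    (hQ : ∀ᶠ v in 𝓝 (midpoint ℝ p q), Q v) : ∃ v, Q v ∧ IsBeyond S p q v := by
  have hleft : ∀ᶠ v in 𝓝 (midpoint ℝ p q), ∀ w ∈ S, 0 < orient p q w → 0 < orient p v w := by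
    filter_upwards [eventually_forall_mem_pos (f := orient p) (fun _ => by fun_prop) S
      (midpoint ℝ p q)] with v hv w hw hpqw
    refine hv w hw ?_
    rw [orient_swap_right, orient_midpoint, orient_self_left, orient_swap_right]
    linarith
  have hright : ∀ᶠ v in 𝓝 (midpoint ℝ p q), ∀ w ∈ S, 0 < orient p q w → 0 < orient v q w := by
    filter_upwards [eventually_forall_mem_pos (f := (orient · q)) (fun _ => by fun_prop) S
      (midpoint ℝ p q)] with v hv w hw hpqw
    refine hv w hw ?_
    rw [← orient_rotate, orient_midpoint, orient_self_left, orient_rotate]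
    linarith
  obtain ⟨v, hv, ⟨hvQ, hvl, hvr⟩, hg⟩ := exists_isGeneric S (isOpen_orient_neg p q)
    (mem_closure_orient_neg hpq (by simp [orient_midpoint])) (hQ.and (hleft.and hright))
  exact ⟨v, hvQ, hg, hv, hvl, hvr⟩

end GenericPoints

section PlaneGraphs

variable {S N N' : Finset (ℝ × ℝ)} {T E : Finset (Sym2 (ℝ × ℝ))} {a b c d p q v x : ℝ × ℝ}
  {Q : ℝ × ℝ → Prop}

/-- The edges of the star with center `v` and leaves `N`. -/
noncomputable def starEdges (v : ℝ × ℝ) (N : Finset (ℝ × ℝ)) : Finset (Sym2 (ℝ × ℝ)) :=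
  N.image (s(v, ·))

theorem mem_starEdges : s(c, d) ∈ starEdges v N ↔ c = v ∧ d ∈ N ∨ d = v ∧ c ∈ N := by
  simp only [starEdges, Finset.mem_image, Sym2.eq_iff]
  grind

theorem starEdges_mono (hN : N ⊆ N') : starEdges v N ⊆ starEdges v N' :=
  Finset.image_subset_image hN

theorem mk_mem_starEdges (hx : x ∈ N) : s(v, x) ∈ starEdges v N :=
  Finset.mem_image_of_mem _ hx

/-- A straight-line plane graph with vertex set `S` in general position and edge set `T`. For
points in general position, edges with a common end cannot meet elsewhere, so only edges with four
distinct ends are required to be disjoint. -/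
structure IsPlaneGraph (S : Finset (ℝ × ℝ)) (T : Finset (Sym2 (ℝ × ℝ))) : Prop where
  orient_ne : ∀ a ∈ S, ∀ b ∈ S, ∀ c ∈ S, a ≠ b → a ≠ c → b ≠ c → orient a b c ≠ 0
  mem : ∀ a b, s(a, b) ∈ T → a ∈ S
  ne : ∀ a b, s(a, b) ∈ T → a ≠ b
  noncrossing : ∀ a b c d, s(a, b) ∈ T → s(c, d) ∈ T → a ≠ c → a ≠ d → b ≠ c → b ≠ d →
    Disjoint (segment ℝ a b) (segment ℝ c d)

namespace IsPlaneGraph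

theorem mem_right (h : IsPlaneGraph S T) (hab : s(a, b) ∈ T) : b ∈ S :=
  h.mem b a (Sym2.eq_swap ▸ hab)

theorem mono (h : IsPlaneGraph S T) (hE : E ⊆ T) : IsPlaneGraph S E where
  orient_ne := h.orient_ne
  mem _ _ hab := h.mem _ _ (hE hab)
  ne _ _ hab := h.ne _ _ (hE hab)
  noncrossing _ _ _ _ hab hcd := h.noncrossing _ _ _ _ (hE hab) (hE hcd)

theorem nontrivial (h : IsPlaneGraph S T) (hpq : s(p, q) ∈ T) : S.Nontrivial :=
  ⟨p, h.mem _ _ hpq, q, h.mem_right hpq, h.ne _ _ hpq⟩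

theorem insert_star (h : IsPlaneGraph S T) (hv : v ∉ S) (hg : IsGeneric S v) (hN : N ⊆ S)
    (hdisj : ∀ x ∈ N, ∀ c d, s(c, d) ∈ T → x ≠ c → x ≠ d →
      Disjoint (segment ℝ v x) (segment ℝ c d)) :
    IsPlaneGraph (insert v S) (T ∪ starEdges v N) where
  orient_ne := by
    simp only [Finset.forall_mem_insert]
    refine ⟨⟨?_, fun b hb => ⟨?_, fun c hc _ _ hbc => ?_⟩⟩, fun a ha =>
      ⟨⟨?_, fun c hc _ hac _ => ?_⟩, fun b hb =>
        ⟨fun hab _ _ => hg a ha b hb hab, h.orient_ne a ha b hb⟩⟩⟩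
    · simp
    · simp
    · rw [← orient_rotate]; exact hg b hb c hc hbc
    · simp
    · rw [orient_rotate]; exact hg c hc a ha hac.symm
  mem a b hab := by
    rcases Finset.mem_union.1 hab with hab | hab
    · exact Finset.mem_insert_of_mem (h.mem _ _ hab)
    · rcases mem_starEdges.1 hab with ⟨rfl, -⟩ | ⟨-, ha⟩
      exacts [Finset.mem_insert_self _ _, Finset.mem_insert_of_mem (hN ha)]
  ne a b hab := by
    rcases Finset.mem_union.1 hab with hab | hab
    · exact h.ne _ _ hab
    · rcases mem_starEdges.1 hab with ⟨rfl, hb⟩ | ⟨rfl, ha⟩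
      exacts [(ne_of_mem_of_not_mem (hN hb) hv).symm, ne_of_mem_of_not_mem (hN ha) hv]
  noncrossing := by
    have hstar {a b c d : ℝ × ℝ} (hab : s(a, b) ∈ starEdges v N) (hcd : s(c, d) ∈ T)
        (hac : a ≠ c) (had : a ≠ d) (hbc : b ≠ c) (hbd : b ≠ d) :
        Disjoint (segment ℝ a b) (segment ℝ c d) := by
      rcases mem_starEdges.1 hab with ⟨rfl, hb⟩ | ⟨rfl, ha⟩
      · exact hdisj b hb c d hcd hbc hbd
      · rw [segment_symm]
        exact hdisj a ha c d hcd hac had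
    intro a b c d hab hcd hac had hbc hbd
    rcases Finset.mem_union.1 hab with hab | hab <;> rcases Finset.mem_union.1 hcd with hcd | hcd
    · exact h.noncrossing a b c d hab hcd hac had hbc hbd
    · exact (hstar hcd hab hac.symm hbc.symm had.symm hbd.symm).symm
    · exact hstar hab hcd hac had hbc hbd
    · grind [mem_starEdges]

theorem card_union_star (h : IsPlaneGraph S T) (hv : v ∉ S) :
    (T ∪ starEdges v N).card = T.card + N.card := by
  have hdisj : Disjoint T (starEdges v N) := by
    rw [starEdges, Finset.disjoint_right, Finset.forall_mem_image]
    exact fun x _ hx => hv (h.mem v x hx)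
  rw [Finset.card_union_of_disjoint hdisj, starEdges,
    Finset.card_image_of_injective _ (fun _ _ => Sym2.congr_right.1)]

theorem disjoint_segment_midpoint (h : IsPlaneGraph S T) (hpq : s(p, q) ∈ T) (hcd : s(c, d) ∈ T)
    (hpc : p ≠ c) (hpd : p ≠ d) :
    Disjoint (segment ℝ (midpoint ℝ p q) p) (segment ℝ c d) := by
  have hp := h.mem _ _ hpq
  have hcd' := h.ne _ _ hcd
  have hc := h.mem _ _ hcd
  have hd := h.mem_right hcd
  rcases eq_or_ne q c with rfl | hqc
  · exact _root_.disjoint_segment_midpoint (h.orient_ne q hc d hd p hp hcd' hpc.symm hpd.symm)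
  rcases eq_or_ne q d with rfl | hqd
  · rw [segment_symm ℝ c q]
    exact _root_.disjoint_segment_midpoint (h.orient_ne q hd c hc p hp hcd'.symm hpd.symm hpc.symm)
  · exact (h.noncrossing p q c d hpq hcd hpc hpd hqc hqd).mono_left <|
      (convex_segment p q).segment_subset (midpoint_mem_segment p q) (left_mem_segment ℝ p q)

theorem midpoint_notMem_segment (h : IsPlaneGraph S T) (hpq : s(p, q) ∈ T) (hcd : s(c, d) ∈ T)
    (hne : s(c, d) ≠ s(p, q)) : midpoint ℝ p q ∉ segment ℝ c d := by
  by_cases hp : p ≠ c ∧ p ≠ d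
  · exact Set.disjoint_left.1 (h.disjoint_segment_midpoint hpq hcd hp.1 hp.2)
      (left_mem_segment ℝ _ p)
  · have hq : q ≠ c ∧ q ≠ d := by
      have := h.ne _ _ hpq
      rw [Ne, Sym2.eq_iff] at hne
      grind
    rw [midpoint_comm]
    exact Set.disjoint_left.1 (h.disjoint_segment_midpoint (Sym2.eq_swap ▸ hpq) hcd hq.1 hq.2)
      (left_mem_segment ℝ _ q)

theorem eventually_forall_edge {X : Type*} {l : Filter X} {P : ℝ × ℝ → ℝ × ℝ → X → Prop}
    (h : IsPlaneGraph S T) (hP : ∀ c d, s(c, d) ∈ T → ∀ᶠ x in l, P c d x) :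
    ∀ᶠ x in l, ∀ c d, s(c, d) ∈ T → P c d x := by
  have hfin : ∀ᶠ x in l, ∀ c ∈ S, ∀ d ∈ S, s(c, d) ∈ T → P c d x := by
    simpa only [eventually_all_finset, eventually_imp_distrib_left] using
      fun c _ d _ hcd => hP c d hcd
  exact hfin.mono fun x hx c d hcd => hx c (h.mem _ _ hcd) d (h.mem_right hcd) hcd

theorem eventually_disjoint_left (h : IsPlaneGraph S T) (hpq : s(p, q) ∈ T) :
    ∀ᶠ v in 𝓝 (midpoint ℝ p q), ∀ c d, s(c, d) ∈ T → p ≠ c → p ≠ d →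
      Disjoint (segment ℝ v p) (segment ℝ c d) := by
  refine h.eventually_forall_edge fun c d hcd => ?_
  simp only [eventually_imp_distrib_left]
  exact fun hpc hpd => (Continuous.prodMk_left p).continuousAt.eventually <|
    eventually_disjoint_segment (isClosed_segment c d) (h.disjoint_segment_midpoint hpq hcd hpc hpd)

theorem eventually_disjoint_pair (h : IsPlaneGraph S T) (hpq : s(p, q) ∈ T) :
    ∀ᶠ u in 𝓝 (midpoint ℝ p q), ∀ᶠ u' in 𝓝 (midpoint ℝ p q), ∀ c d, s(c, d) ∈ T →
      s(c, d) ≠ s(p, q) → Disjoint (segment ℝ u' u) (segment ℝ c d) := by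
  have hpair : ∀ᶠ x in 𝓝 (midpoint ℝ p q, midpoint ℝ p q), ∀ c d, s(c, d) ∈ T →
      s(c, d) ≠ s(p, q) → Disjoint (segment ℝ x.2 x.1) (segment ℝ c d) := by
    refine h.eventually_forall_edge fun c d hcd => ?_
    simp only [eventually_imp_distrib_left, segment_symm ℝ (Prod.snd _)]
    refine fun hne => eventually_disjoint_segment (isClosed_segment c d) ?_
    simpa [segment_same] using h.midpoint_notMem_segment hpq hcd hne
  rw [nhds_prod_eq] at hpair
  exact hpair.curry

theorem exists_insert_beyond (h : IsPlaneGraph S T) (hpq : s(p, q) ∈ T)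
    (hQ : ∀ᶠ v in 𝓝 (midpoint ℝ p q), Q v) :
    ∃ v ∉ S, Q v ∧ IsBeyond S p q v ∧ IsPlaneGraph (insert v S) (T ∪ starEdges v {p, q}) := by
  have hq := h.eventually_disjoint_left (Sym2.eq_swap ▸ hpq : s(q, p) ∈ T)
  rw [midpoint_comm] at hq
  obtain ⟨v, ⟨⟨hvp, hvq⟩, hvQ⟩, hv⟩ := exists_isBeyond S (h.ne _ _ hpq)
    (((h.eventually_disjoint_left hpq).and hq).and hQ)
  have hvS := hv.generic.notMem (h.nontrivial hpq)
  refine ⟨v, hvS, hvQ, hv, h.insert_star hvS hv.generic ?_ ?_⟩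
  · simp [Finset.insert_subset_iff, h.mem _ _ hpq, h.mem_right hpq]
  · simpa only [Finset.forall_mem_insert, Finset.mem_singleton, forall_eq] using ⟨hvp, hvq⟩

theorem exists_insert_pair (h : IsPlaneGraph S T) (hpq : s(p, q) ∈ T)
    (hQ : ∀ᶠ v in 𝓝 (midpoint ℝ p q), Q v) :
    ∃ u ∉ S, ∃ u' ∉ insert u S, Q u ∧ Q u' ∧ IsBeyond S p q u ∧ IsBeyond (insert u S) p q u' ∧
      IsPlaneGraph (insert u' (insert u S)) (T ∪ starEdges u {p, q} ∪ starEdges u' {u}) ∧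
      (T ∪ starEdges u {p, q} ∪ starEdges u' {u}).card = T.card + 3 := by
  obtain ⟨u, huS, ⟨huu', huQ⟩, hu, hplane⟩ :=
    h.exists_insert_beyond hpq ((h.eventually_disjoint_pair hpq).and hQ)
  obtain ⟨u', ⟨hdisj, hu'Q⟩, hu'⟩ := exists_isBeyond (insert u S) (h.ne _ _ hpq) (huu'.and hQ)
  have hu'S := hu'.generic.notMem ((h.nontrivial hpq).mono (Finset.subset_insert u S))
  refine ⟨u, huS, u', hu'S, huQ, hu'Q, hu, hu', hplane.insert_star hu'S hu'.generic (by simp) ?_,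
    by rw [hplane.card_union_star hu'S, h.card_union_star huS, Finset.card_pair (h.ne _ _ hpq),
      Finset.card_singleton]⟩
  simp only [Finset.mem_singleton, forall_eq]
  intro c d hcd huc hud
  replace hcd : s(c, d) ∈ T := (Finset.mem_union.1 hcd).resolve_right fun hcd => by
    rcases mem_starEdges.1 hcd with ⟨rfl, -⟩ | ⟨rfl, -⟩
    exacts [huc rfl, hud rfl]
  by_cases hne : s(c, d) = s(p, q)
  · have hcd0 : orient q p c ≤ 0 ∧ orient q p d ≤ 0 := by
      rcases Sym2.eq_iff.1 hne with ⟨rfl, rfl⟩ | ⟨rfl, rfl⟩ <;> simp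
    refine (disjoint_segment_of_orient_pos hcd0.1 hcd0.2 ?_ ?_).symm <;> rw [orient_swap_left]
    exacts [neg_pos.2 hu'.orient_neg, neg_pos.2 hu.orient_neg]
  · exact hdisj c d hcd hne

end IsPlaneGraph

end PlaneGraphs

section HullEdges

variable {S : Finset (ℝ × ℝ)} {c d p q v w : ℝ × ℝ}

/-- `p q` is an edge of the convex hull of `S`, directed so that the other points of `S` lie to the
left. -/
structure IsHullEdge (S : Finset (ℝ × ℝ)) (p q : ℝ × ℝ) : Prop where
  left_mem : p ∈ S
  right_mem : q ∈ S
  ne : p ≠ q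
  orient_pos : ∀ w ∈ S, w ≠ p → w ≠ q → 0 < orient p q w

namespace IsHullEdge

theorem orient_nonneg (h : IsHullEdge S p q) (hw : w ∈ S) : 0 ≤ orient p q w := by
  by_cases hp : w = p
  · simp [hp]
  by_cases hq : w = q
  · simp [hq]
  exact (h.orient_pos w hw hp hq).le

theorem nontrivial (h : IsHullEdge S p q) : S.Nontrivial :=
  ⟨p, h.left_mem, q, h.right_mem, h.ne⟩

theorem disjoint_segment (h : IsHullEdge S p q) (hc : c ∈ S) (hd : d ∈ S) (hpc : p ≠ c)
    (hqc : q ≠ c) (hpd : p ≠ d) (hqd : q ≠ d) : Disjoint (segment ℝ p q) (segment ℝ c d) :=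
  disjoint_segment_of_orient_pos (orient_self_left p q).le (orient_self_right p q).le
    (h.orient_pos c hc hpc.symm hqc.symm) (h.orient_pos d hd hpd.symm hqd.symm)

theorem insert_left (h : IsHullEdge S p q) (hv : v ∉ S) (hneg : orient p q v < 0)
    (hpos : ∀ w ∈ S, 0 < orient p q w → 0 < orient p v w) : IsHullEdge (insert v S) p v where
  left_mem := Finset.mem_insert_of_mem h.left_mem
  right_mem := Finset.mem_insert_self v S
  ne := ne_of_mem_of_not_mem h.left_mem hv
  orient_pos w hw hwp hwv := by
    have hwS := (Finset.mem_insert.1 hw).resolve_left hwv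
    rcases eq_or_ne w q with rfl | hwq
    · rw [orient_swap_right]; exact neg_pos.2 hneg
    · exact hpos w hwS (h.orient_pos w hwS hwp hwq)

theorem insert_right (h : IsHullEdge S p q) (hv : v ∉ S) (hneg : orient p q v < 0)
    (hpos : ∀ w ∈ S, 0 < orient p q w → 0 < orient v q w) : IsHullEdge (insert v S) v q where
  left_mem := Finset.mem_insert_self v S
  right_mem := Finset.mem_insert_of_mem h.right_mem
  ne := (ne_of_mem_of_not_mem h.right_mem hv).symm
  orient_pos w hw hwv hwq := by
    have hwS := (Finset.mem_insert.1 hw).resolve_left hwv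
    rcases eq_or_ne w p with rfl | hwp
    · rw [orient_rotate, orient_swap_right]; exact neg_pos.2 hneg
    · exact hpos w hwS (h.orient_pos w hwS hwp hwq)

theorem insert (h : IsHullEdge S p q) (hv : 0 < orient p q v) : IsHullEdge (insert v S) p q where
  left_mem := Finset.mem_insert_of_mem h.left_mem
  right_mem := Finset.mem_insert_of_mem h.right_mem
  ne := h.ne
  orient_pos := by simpa only [Finset.forall_mem_insert] using ⟨fun _ _ => hv, h.orient_pos⟩

end IsHullEdge

end HullEdges

section Saturation

variable {A A' N N' S : Finset (ℝ × ℝ)} {H H' T : Finset (Sym2 (ℝ × ℝ))} {p q u v w : ℝ × ℝ}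
  {Q : ℝ × ℝ → Prop}

/-- The segment `u v` meets an edge of `H` that ends neither in `u` nor in `v`. -/
def Blocked (H : Finset (Sym2 (ℝ × ℝ))) (u v : ℝ × ℝ) : Prop :=
  ∃ c d, s(c, d) ∈ H ∧ u ≠ c ∧ u ≠ d ∧ v ≠ c ∧ v ≠ d ∧ (segment ℝ u v ∩ segment ℝ c d).Nonempty

theorem Blocked.symm (h : Blocked H u v) : Blocked H v u := by
  obtain ⟨c, d, hcd, huc, hud, hvc, hvd, hne⟩ := h
  exact ⟨c, d, hcd, hvc, hvd, huc, hud, segment_symm ℝ u v ▸ hne⟩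

theorem Blocked.mono (h : Blocked H u v) (hH : H ⊆ H') : Blocked H' u v := by
  obtain ⟨c, d, hcd, h⟩ := h
  exact ⟨c, d, hH hcd, h⟩

theorem blocked_of_orient (hpq : s(p, q) ∈ H) (hv : orient p q v < 0) (hw : 0 < orient p q w)
    (hp : 0 < orient p v w) (hq : 0 < orient v q w) : Blocked H v w := by
  refine ⟨p, q, hpq, ?_, ?_, ?_, ?_, segment_inter_segment_nonempty hv hw hp hq⟩ <;>
    rintro rfl <;> simp at hv hw

theorem IsBeyond.blocked (h : IsBeyond S p q v) (hpq : s(p, q) ∈ H) (hwS : w ∈ S)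
    (hw : 0 < orient p q w) : Blocked H v w :=
  blocked_of_orient hpq h.orient_neg hw (h.orient_left_pos w hwS hw) (h.orient_right_pos w hwS hw)

/-- No edge between two points of `A` can be added to the plane graph `H`: each is either present or
crossed. -/
def IsSaturatedOn (H : Finset (Sym2 (ℝ × ℝ))) (A : Finset (ℝ × ℝ)) : Prop :=
  (A : Set (ℝ × ℝ)).Pairwise fun u v => s(u, v) ∈ H ∨ Blocked H u v

namespace IsSaturatedOn

theorem mono (h : IsSaturatedOn H A) (hH : H ⊆ H') : IsSaturatedOn H' A :=
  Set.Pairwise.mono' (fun _ _ => Or.imp (@hH _) (Blocked.mono · hH)) h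

theorem anti (h : IsSaturatedOn H A) (hA : A' ⊆ A) : IsSaturatedOn H A' :=
  Set.Pairwise.mono (Finset.coe_subset.2 hA) h

theorem insert (h : IsSaturatedOn H A) (hv : ∀ w ∈ A, v ≠ w → s(v, w) ∈ H ∨ Blocked H v w) :
    IsSaturatedOn H (insert v A) := by
  have : Std.Symm fun u v => s(u, v) ∈ H ∨ Blocked H u v :=
    ⟨fun u v => Or.imp (Sym2.eq_swap ▸ ·) Blocked.symm⟩
  rw [IsSaturatedOn, Finset.coe_insert, Set.pairwise_insert_of_symm]
  exact ⟨h, hv⟩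

end IsSaturatedOn

/-- A plane graph with vertex set `S` and edge set `T`, with edges `H` that make it impossible to
join two of the free points `A`. If `M ⊆ H` is a perfect matching of the other points, then `M` is a
maximal compatible matching of every graph between `H \ M` and `T \ M`. -/
structure IsScaffold (S A : Finset (ℝ × ℝ)) (H T : Finset (Sym2 (ℝ × ℝ))) : Prop where
  plane : IsPlaneGraph S T
  free_subset : A ⊆ S
  frame_subset : H ⊆ T
  saturated : IsSaturatedOn H A

namespace IsScaffold

theorem plane_frame (h : IsScaffold S A H T) : IsPlaneGraph S H :=
  h.plane.mono h.frame_subset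

theorem orient_pos_of_mem_free (h : IsScaffold S A H T) (hpq : IsHullEdge S p q) (hp : p ∉ A)
    (hq : q ∉ A) : ∀ w ∈ A, 0 < orient p q w := fun w hw =>
  hpq.orient_pos w (h.free_subset hw) (ne_of_mem_of_not_mem hw hp) (ne_of_mem_of_not_mem hw hq)

theorem insert_star (h : IsScaffold S A H T) (hN : N' ⊆ N)
    (hplane : IsPlaneGraph (insert v S) (T ∪ starEdges v N)) :
    IsScaffold (insert v S) A (H ∪ starEdges v N') (T ∪ starEdges v N) where
  plane := hplane
  free_subset := h.free_subset.trans (Finset.subset_insert v S)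
  frame_subset := Finset.union_subset_union h.frame_subset (starEdges_mono hN)
  saturated := h.saturated.mono Finset.subset_union_left

theorem exists_insert_pair (h : IsScaffold S A H T) (hpq : s(p, q) ∈ H)
    (hA : ∀ w ∈ A, 0 < orient p q w) (hQ : ∀ᶠ v in 𝓝 (midpoint ℝ p q), Q v) :
    ∃ u ∉ S, ∃ u' ∉ insert u S, ∃ H' T', Q u ∧ Q u' ∧
      IsScaffold (insert u' (insert u S)) (insert u' (insert u A)) H' T' ∧ H ⊆ H' ∧
      H'.card = H.card + 1 ∧ T'.card = T.card + 3 := by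
  obtain ⟨u, huS, u', hu'S, huQ, hu'Q, hu, hu', hplane, hcard⟩ :=
    h.plane.exists_insert_pair (h.frame_subset hpq) hQ
  have hHH' : H ⊆ H ∪ starEdges u' {u} := Finset.subset_union_left
  refine ⟨u, huS, u', hu'S, _, _, huQ, hu'Q, ⟨hplane, ?_, ?_, ?_⟩, hHH', ?_, hcard⟩
  · exact Finset.insert_subset_insert u' (Finset.insert_subset_insert u h.free_subset)
  · exact Finset.union_subset_union_left (h.frame_subset.trans Finset.subset_union_left)
  · refine ((h.saturated.mono hHH').insert fun w hw _ => Or.inr ?_).insert ?_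
    · exact hu.blocked (hHH' hpq) (h.free_subset hw) (hA w hw)
    · rw [Finset.forall_mem_insert]
      refine ⟨fun _ => Or.inl ?_, fun w hw _ => Or.inr ?_⟩
      · exact Finset.mem_union_right H (mk_mem_starEdges (Finset.mem_singleton_self u))
      · exact hu'.blocked (hHH' hpq) (Finset.mem_insert_of_mem (h.free_subset hw)) (hA w hw)
  · exact h.plane_frame.card_union_star fun hu' => hu'S (Finset.mem_insert_of_mem hu')

theorem exists_insert_five (h : IsScaffold S A H T) (hpq : IsHullEdge S p q) (hH : s(p, q) ∈ H)
    (hp : p ∉ A) (hq : q ∉ A) :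
    ∃ z ∉ S, ∃ S' A' H' T', IsScaffold S' A' H' T' ∧ S' \ A' = insert z (S \ A) ∧
      IsHullEdge S' z q ∧ s(z, p) ∈ H' ∧ s(z, q) ∈ H' ∧ H ⊆ H' ∧
      S'.card = S.card + 5 ∧ H'.card = H.card + 4 ∧ T'.card = T.card + 8 := by
  have hA := h.orient_pos_of_mem_free hpq hp hq
  obtain ⟨z, hz, -, hzb, hplane⟩ := h.plane.exists_insert_beyond (h.frame_subset hH)
    (Eventually.of_forall fun _ => trivial)
  have h₁ := h.insert_star (N' := {p, q}) subset_rfl hplane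
  have hpzq : 0 < orient p z q := by rw [orient_swap_right]; exact neg_pos.2 hzb.orient_neg
  have hzqp : 0 < orient z q p := by rwa [orient_rotate]
  obtain ⟨u, hu, u', hu', H₂, T₂, ⟨hpu, hzu⟩, ⟨hpu', hzu'⟩, h₂, hH₂, hcardH₂, hcardT₂⟩ :=
    h₁.exists_insert_pair (Finset.mem_union_left _ hH) hA
      ((eventually_midpoint_orient_pos (a := p) (b := z) (by simpa)).and
        (eventually_midpoint_orient_pos (a := z) (b := q) (by simpa)))
  have hstar : ∀ x ∈ ({p, q} : Finset (ℝ × ℝ)), s(z, x) ∈ H₂ := fun x hx =>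
    hH₂ (Finset.mem_union_right _ (mk_mem_starEdges hx))
  obtain ⟨v, hv, v', hv', H₃, T₃, hzv, hzv', h₃, hH₃, hcardH₃, hcardT₃⟩ :=
    h₂.exists_insert_pair (p := p) (q := z) (Sym2.eq_swap ▸ hstar p (by simp))
      (by
        simp only [Finset.forall_mem_insert]
        exact ⟨hpu', hpu, fun w hw => hzb.orient_left_pos w (h.free_subset hw) (hA w hw)⟩)
      (eventually_midpoint_orient_pos (a := z) (b := q) (by simpa))
  refine ⟨z, hz, _, _, H₃, T₃, h₃, ?_, ?_, hH₃ (hstar p (by simp)), hH₃ (hstar q (by simp)),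
    (Finset.subset_union_left.trans hH₂).trans hH₃, ?_, ?_, ?_⟩
  · rw [Finset.insert_sdiff_insert, Finset.sdiff_insert_of_notMem hv', Finset.insert_sdiff_insert,
      Finset.sdiff_insert_of_notMem hv, Finset.insert_sdiff_insert,
      Finset.sdiff_insert_of_notMem hu', Finset.insert_sdiff_insert,
      Finset.sdiff_insert_of_notMem hu, Finset.insert_sdiff_of_notMem _ (mt (@h.free_subset z) hz)]
  · exact ((((hpq.insert_right hz hzb.orient_neg hzb.orient_right_pos).insert hzu).insert
      hzu').insert hzv).insert hzv'
  · simp only [Finset.card_insert_of_notMem, hz, hu, hu', hv, hv', not_false_eq_true]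
  · rw [hcardH₃, hcardH₂, h.plane_frame.card_union_star hz, Finset.card_pair hpq.ne]
  · rw [hcardT₃, hcardT₂, h.plane.card_union_star hz, Finset.card_pair hpq.ne]

end IsScaffold

end Saturation

section HullVertices

variable {S : Finset (ℝ × ℝ)} {G T : Finset (Sym2 (ℝ × ℝ))} {p q v x y z : ℝ × ℝ}

theorem IsScaffold.exists_insert_vertex (h : IsScaffold S S G G) (hpq : IsHullEdge S p q)
    (hG : s(p, q) ∈ G) :
    ∃ v ∉ S, IsScaffold (insert v S) (insert v S) (G ∪ starEdges v {p, q})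
      (G ∪ starEdges v {p, q}) ∧ IsHullEdge (insert v S) p v ∧ IsHullEdge (insert v S) v q := by
  obtain ⟨v, hvS, -, hv, hplane⟩ :=
    h.plane.exists_insert_beyond hG (Eventually.of_forall fun _ => trivial)
  refine ⟨v, hvS, ⟨hplane, subset_rfl, subset_rfl, ?_⟩,
    hpq.insert_left hvS hv.orient_neg hv.orient_left_pos,
    hpq.insert_right hvS hv.orient_neg hv.orient_right_pos⟩
  refine (h.saturated.mono Finset.subset_union_left).insert fun w hw _ => ?_
  by_cases hwpq : w ∈ ({p, q} : Finset (ℝ × ℝ))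
  · exact Or.inl (Finset.mem_union_right G (mk_mem_starEdges hwpq))
  · obtain ⟨hwp, hwq⟩ : w ≠ p ∧ w ≠ q := by simpa using hwpq
    exact Or.inr (hv.blocked (Finset.mem_union_left _ hG) hw (hpq.orient_pos w hw hwp hwq))

/-- The generic point `v` lies outside both lines `x y` and `y z`, so close to `y` that replacing
`y` by `v` leaves every point of `S` on its side of these lines. -/
structure IsBeyondCorner (S : Finset (ℝ × ℝ)) (x y z v : ℝ × ℝ) : Prop where
  generic : IsGeneric S v
  orient_left_neg : orient x y v < 0
  orient_right_neg : orient y z v < 0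
  orient_left_pos : ∀ w ∈ S, 0 < orient x y w → 0 < orient x v w
  orient_right_pos : ∀ w ∈ S, 0 < orient y z w → 0 < orient v z w

theorem mem_closure_orient_neg_inter (h : 0 < orient x y z) :
    y ∈ closure ({v | orient x y v < 0} ∩ {v | orient y z v < 0}) := by
  -- The reflection in `y` of the fourth vertex of the parallelogram spanned by `x y` and `y z`.
  refine mem_closure_of_forall_lineMap_mem (w := (3 : ℝ) • y - x - z) fun t ht => ?_
  have hw : orient x y ((3 : ℝ) • y - x - z) = -orient x y z ∧
      orient y z ((3 : ℝ) • y - x - z) = -orient x y z := by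
    simp only [orient, Prod.fst_sub, Prod.snd_sub, Prod.smul_fst, Prod.smul_snd, smul_eq_mul]
    constructor <;> ring
  have hneg : t * -orient x y z < 0 := mul_neg_of_pos_of_neg ht (neg_neg_of_pos h)
  simpa [orient_lineMap, hw] using hneg

theorem exists_isBeyondCorner (S : Finset (ℝ × ℝ)) (h : 0 < orient x y z) :
    ∃ v, IsBeyondCorner S x y z v := by
  obtain ⟨v, ⟨hxy, hyz⟩, ⟨hl, hr⟩, hg⟩ := exists_isGeneric S
    ((isOpen_orient_neg x y).inter (isOpen_orient_neg y z)) (mem_closure_orient_neg_inter h)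
    ((eventually_forall_mem_pos (f := orient x) (fun _ => by fun_prop) S y).and
      (eventually_forall_mem_pos (f := (orient · z)) (fun _ => by fun_prop) S y))
  exact ⟨v, hg, hxy, hyz, hl, hr⟩

namespace IsBeyondCorner

theorem isPlaneGraph (hv : IsBeyondCorner S x y z v) (h : IsPlaneGraph S T)
    (hxy : IsHullEdge S x y) (hyz : IsHullEdge S y z) (hxz : x ≠ z) :
    IsPlaneGraph (insert v S) (T ∪ starEdges v {x, y, z}) := by
  have hvS := hv.generic.notMem hxy.nontrivial
  have hxv := hxy.insert_left hvS hv.orient_left_neg hv.orient_left_pos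
  have hvz := hyz.insert_right hvS hv.orient_right_neg hv.orient_right_pos
  have hsum : ∀ w ∈ S, y ≠ w → 0 < orient x y w + orient y z w := by
    intro w hw hyw
    rcases eq_or_ne w x with rfl | hwx
    · simpa using hyz.orient_pos w hw hyw.symm hxz
    · exact add_pos_of_pos_of_nonneg (hxy.orient_pos w hw hwx hyw.symm) (hyz.orient_nonneg hw)
  refine h.insert_star hvS hv.generic ?_ ?_
  · simp [Finset.insert_subset_iff, hxy.left_mem, hxy.right_mem, hyz.right_mem]
  intro w hw c d hcd hwc hwd
  have hc := h.mem _ _ hcd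
  have hd := h.mem_right hcd
  have hvc := (ne_of_mem_of_not_mem hc hvS).symm
  have hvd := (ne_of_mem_of_not_mem hd hvS).symm
  simp only [Finset.mem_insert, Finset.mem_singleton] at hw
  rcases hw with rfl | rfl | rfl
  · rw [segment_symm]
    exact hxv.disjoint_segment (Finset.mem_insert_of_mem hc) (Finset.mem_insert_of_mem hd)
      hwc hvc hwd hvd
  · exact disjoint_segment_of_separated ((convexOn_orient x w).add (convexOn_orient w z))
      ((concaveOn_orient x w).add (concaveOn_orient w z))
      (add_neg hv.orient_left_neg hv.orient_right_neg).le (by simp) (hsum c hc hwc) (hsum d hd hwd)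
  · exact hvz.disjoint_segment (Finset.mem_insert_of_mem hc) (Finset.mem_insert_of_mem hd)
      hvc hwc hvd hwd

theorem blocked (hv : IsBeyondCorner S x y z v) (hxy : IsHullEdge S x y)
    (hyz : IsHullEdge S y z) (hxyG : s(x, y) ∈ G) (hyzG : s(y, z) ∈ G) {w : ℝ × ℝ} (hw : w ∈ S)
    (hwx : w ≠ x) (hwy : w ≠ y) (hwz : w ≠ z) : Blocked G v w := by
  have hxyw := hxy.orient_pos w hw hwx hwy
  have hyzw := hyz.orient_pos w hw hwy hwz
  have hne : orient y v w ≠ 0 := by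
    rw [orient_swap_right, neg_ne_zero]
    exact hv.generic y hxy.right_mem w hw hwy.symm
  rcases hne.lt_or_gt with hyvw | hyvw
  · refine blocked_of_orient hxyG hv.orient_left_neg hxyw (hv.orient_left_pos w hw hxyw) ?_
    rw [orient_swap_left]
    exact neg_pos.2 hyvw
  · exact blocked_of_orient hyzG hv.orient_right_neg hyzw hyvw (hv.orient_right_pos w hw hyzw)

end IsBeyondCorner

theorem IsScaffold.exists_insert_corner (h : IsScaffold S S G G) (hxy : IsHullEdge S x y)
    (hyz : IsHullEdge S y z) (hxz : x ≠ z) (hxyG : s(x, y) ∈ G) (hyzG : s(y, z) ∈ G) :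
    ∃ v ∉ S, IsScaffold (insert v S) (insert v S) (G ∪ starEdges v {x, y, z})
      (G ∪ starEdges v {x, y, z}) ∧ IsHullEdge (insert v S) x v ∧ IsHullEdge (insert v S) v z := by
  obtain ⟨v, hv⟩ := exists_isBeyondCorner S (hxy.orient_pos z hyz.right_mem hxz.symm hyz.ne.symm)
  have hvS := hv.generic.notMem hxy.nontrivial
  refine ⟨v, hvS, ⟨hv.isPlaneGraph h.plane hxy hyz hxz, subset_rfl, subset_rfl, ?_⟩,
    hxy.insert_left hvS hv.orient_left_neg hv.orient_left_pos,
    hyz.insert_right hvS hv.orient_right_neg hv.orient_right_pos⟩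
  refine (h.saturated.mono Finset.subset_union_left).insert fun w hw _ => ?_
  by_cases hwN : w ∈ ({x, y, z} : Finset (ℝ × ℝ))
  · exact Or.inl (Finset.mem_union_right G (mk_mem_starEdges hwN))
  · obtain ⟨hwx, hwy, hwz⟩ : w ≠ x ∧ w ≠ y ∧ w ≠ z := by simpa using hwN
    exact Or.inr ((hv.blocked hxy hyz hxyG hyzG hw hwx hwy hwz).mono
      Finset.subset_union_left)

theorem isScaffold_pair (hpq : p ≠ q) : IsScaffold {p, q} {p, q} {s(p, q)} {s(p, q)} where
  plane := by
    have hempty : IsPlaneGraph {q} ∅ := by constructor <;> simp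
    simpa [starEdges] using hempty.insert_star (v := p) (N := {q}) (by simpa)
      (by simp [IsGeneric]) subset_rfl (by simp)
  free_subset := subset_rfl
  frame_subset := subset_rfl
  saturated := by simp [IsSaturatedOn, Set.pairwise_pair]

theorem isHullEdge_pair (hpq : p ≠ q) : IsHullEdge {p, q} p q := by
  constructor <;> simp [hpq]

/-- There is a maximal plane graph on `n` points, with `m` edges, that contains an edge of the
convex hull. -/
def HasSaturatedGraph (n m : ℕ) : Prop :=
  ∃ S G p q, IsScaffold S S G G ∧ IsHullEdge S p q ∧ s(p, q) ∈ G ∧ S.card = n ∧ G.card = m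

namespace HasSaturatedGraph

theorem succ {n m : ℕ} (h : HasSaturatedGraph n m) :
    HasSaturatedGraph (n + 1) (m + 2) := by
  obtain ⟨S, G, p, q, h, hpq, hG, rfl, rfl⟩ := h
  obtain ⟨v, hvS, h', hpv, -⟩ := h.exists_insert_vertex hpq hG
  refine ⟨_, _, p, v, h', hpv, Finset.mem_union_right G (mem_starEdges.2 (by simp)), ?_, ?_⟩
  · exact Finset.card_insert_of_notMem hvS
  · rw [h.plane.card_union_star hvS, Finset.card_pair hpq.ne]

theorem add {n m : ℕ} (h : HasSaturatedGraph n m) (i : ℕ) :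
    HasSaturatedGraph (n + i) (m + 2 * i) := by
  induction i with
  | zero => exact h
  | succ i ih => exact ih.succ

end HasSaturatedGraph

theorem hasSaturatedGraph_polygon (i : ℕ) : HasSaturatedGraph (2 + i) (1 + 2 * i) := by
  have hne : ((0, 0) : ℝ × ℝ) ≠ (1, 0) := by simp
  exact HasSaturatedGraph.add ⟨_, _, _, _, isScaffold_pair hne, isHullEdge_pair hne,
    Finset.mem_singleton_self _, Finset.card_pair hne, Finset.card_singleton _⟩ i

theorem exists_isScaffold_corner (j : ℕ) : ∃ S G x y z, IsScaffold S S G G ∧ IsHullEdge S x y ∧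
    IsHullEdge S y z ∧ x ≠ z ∧ s(x, y) ∈ G ∧ s(y, z) ∈ G ∧
    S.card = 3 + j ∧ G.card = 3 + 3 * j := by
  induction j with
  | zero =>
    obtain ⟨S, G, p, q, h, hpq, hG, hS, hcard⟩ := hasSaturatedGraph_polygon 0
    obtain ⟨v, hvS, h', hpv, hvq⟩ := h.exists_insert_vertex hpq hG
    refine ⟨_, _, p, v, q, h', hpv, hvq, hpq.ne, Finset.mem_union_right G (mem_starEdges.2 ?_),
      Finset.mem_union_right G (mem_starEdges.2 ?_), ?_, ?_⟩
    · simp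
    · simp
    · rw [Finset.card_insert_of_notMem hvS, hS]
    · rw [h.plane.card_union_star hvS, Finset.card_pair hpq.ne, hcard]
  | succ j ih =>
    obtain ⟨S, G, x, y, z, h, hxy, hyz, hxz, hxyG, hyzG, hS, hcard⟩ := ih
    obtain ⟨v, hvS, h', hxv, hvz⟩ := h.exists_insert_corner hxy hyz hxz hxyG hyzG
    refine ⟨_, _, x, v, z, h', hxv, hvz, hxz, Finset.mem_union_right G (mem_starEdges.2 ?_),
      Finset.mem_union_right G (mem_starEdges.2 ?_), ?_, ?_⟩
    · simp
    · simp
    · rw [Finset.card_insert_of_notMem hvS, hS, add_assoc]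
    · rw [h.plane.card_union_star hvS, Finset.card_eq_three.2 ⟨x, y, z, hxy.ne, hxz, hyz.ne, rfl⟩,
        hcard, mul_add, add_assoc]

theorem hasSaturatedGraph_triangulation (i j : ℕ) :
    HasSaturatedGraph (3 + j + i) (3 + 3 * j + 2 * i) := by
  obtain ⟨S, G, x, y, -, h, hxy, -, -, hxyG, -, hS, hcard⟩ := exists_isScaffold_corner j
  exact HasSaturatedGraph.add ⟨S, G, x, y, h, hxy, hxyG, hS, hcard⟩ i

end HullVertices

section MatchedScaffolds

variable {α : Type*} {M : Finset (Sym2 α)} {W : Finset α}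

/-- Perfect matchings, as sets of edges: every edge of `M` joins two points of `W`, and every point
of `W` is on exactly one edge of `M`. -/
structure IsPerfectMatchingOn (M : Finset (Sym2 α)) (W : Finset α) : Prop where
  mem : ∀ a b, s(a, b) ∈ M → a ∈ W
  existsUnique : ∀ a ∈ W, ∃! b, s(a, b) ∈ M

namespace IsPerfectMatchingOn

theorem empty : IsPerfectMatchingOn (∅ : Finset (Sym2 α)) ∅ := by
  constructor <;> simp

theorem insert [DecidableEq α] {y z : α} (h : IsPerfectMatchingOn M W)
    (hy : y ∉ insert z W) (hz : z ∉ W) :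
    IsPerfectMatchingOn (insert s(y, z) M) (insert y (insert z W)) where
  mem a b hab := by
    simp only [Finset.mem_insert, Sym2.eq_iff] at hab ⊢
    grind [h.mem a b]
  existsUnique a ha := by
    simp only [Finset.mem_insert, Sym2.eq_iff, not_or] at ha hy ⊢
    by_cases haW : a ∈ W
    · obtain ⟨b, hb, huniq⟩ := h.existsUnique a haW
      exact ⟨b, Or.inr hb, fun c hc => huniq c (by grind)⟩
    · have haM : ∀ b, s(a, b) ∉ M := fun b hab => haW (h.mem a b hab)
      rcases ha with rfl | rfl | ha
      · exact ⟨z, by simp, by grind⟩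
      · exact ⟨y, by simp, by grind⟩
      · exact absurd ha haW

theorem pair [DecidableEq α] {y z : α} (hyz : y ≠ z) : IsPerfectMatchingOn {s(y, z)} {y, z} := by
  simpa using empty.insert (y := y) (z := z) (by simpa) (by simp)

end IsPerfectMatchingOn

/-- A scaffold with `n` points, `h` frame edges and `t` edges, whose frame contains a perfect
matching, with `k` edges, of the points that are not free. -/
structure IsMatchedScaffold (S A : Finset (ℝ × ℝ)) (H T M : Finset (Sym2 (ℝ × ℝ)))
    (n h t k : ℕ) : Prop extends IsScaffold S A H T where
  matching_subset : M ⊆ H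
  isPerfectMatchingOn : IsPerfectMatchingOn M (S \ A)
  card_points : S.card = n
  card_frame : H.card = h
  card_edges : T.card = t
  card_matching : M.card = k

/-- The existence of a matched scaffold with the given numbers of points and edges. -/
def HasScaffold (n h t k : ℕ) : Prop :=
  ∃ S A H T M, IsMatchedScaffold S A H T M n h t k

/-- The existence of a matched scaffold that can be extended: its frame contains a hull edge with
matched ends. -/
def HasOpenScaffold (n h t k : ℕ) : Prop :=
  ∃ S A H T M p q, IsMatchedScaffold S A H T M n h t k ∧ IsHullEdge S p q ∧ s(p, q) ∈ H ∧
    p ∉ A ∧ q ∉ A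

theorem HasSaturatedGraph.hasScaffold {n m : ℕ} (h : HasSaturatedGraph n m) :
    HasScaffold n m m 1 := by
  obtain ⟨S, G, p, q, h, hpq, hG, hS, hcard⟩ := h
  have hpqS : {p, q} ⊆ S := by simp [Finset.insert_subset_iff, hpq.left_mem, hpq.right_mem]
  exact ⟨S, S \ {p, q}, G, G, {s(p, q)}, {
    plane := h.plane
    free_subset := Finset.sdiff_subset
    frame_subset := subset_rfl
    saturated := h.saturated.anti Finset.sdiff_subset
    matching_subset := Finset.singleton_subset_iff.2 hG
    isPerfectMatchingOn := by
      rw [Finset.sdiff_sdiff_eq_self hpqS]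
      exact IsPerfectMatchingOn.pair hpq.ne
    card_points := hS
    card_frame := hcard
    card_edges := hcard
    card_matching := Finset.card_singleton _ }⟩

theorem HasSaturatedGraph.hasOpenScaffold {n m : ℕ} (h : HasSaturatedGraph n m) :
    HasOpenScaffold (n + 2) (m + 1) (m + 4) 1 := by
  obtain ⟨S, G, p, q, h, hpq, hG, rfl, rfl⟩ := h
  obtain ⟨z, hz, -, hzb, hplane⟩ := h.plane.exists_insert_beyond hG
    (Eventually.of_forall fun _ => trivial)
  have hzq := hpq.insert_right hz hzb.orient_neg hzb.orient_right_pos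
  obtain ⟨y, hy, -, hyb, hplane'⟩ := hplane.exists_insert_beyond (p := z) (q := q)
    (Finset.mem_union_right G (mk_mem_starEdges (by simp))) (Eventually.of_forall fun _ => trivial)
  have h₁ := h.insert_star (Finset.empty_subset _) hplane
  have h₂ := h₁.insert_star (N' := {z}) (by simp) hplane'
  have hyz : s(z, y) ∈ G ∪ starEdges z ∅ ∪ starEdges y {z} :=
    Finset.mem_union_right _ (mem_starEdges.2 (by simp))
  refine ⟨_, _, _, _, {s(z, y)}, z, y, ⟨h₂, Finset.singleton_subset_iff.2 hyz, ?_, ?_, ?_, ?_,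
    Finset.card_singleton _⟩, hzq.insert_left hy hyb.orient_neg hyb.orient_left_pos, hyz, hz,
    fun hyS => hy (Finset.mem_insert_of_mem hyS)⟩
  · have hfree : insert y (insert z S) \ S = {z, y} := by grind
    rw [hfree]
    exact IsPerfectMatchingOn.pair (ne_of_mem_of_not_mem (Finset.mem_insert_self z S) hy)
  · rw [Finset.card_insert_of_notMem hy, Finset.card_insert_of_notMem hz]
  · rw [h₁.plane_frame.card_union_star hy, h.plane.card_union_star hz]
    simp
  · rw [hplane.card_union_star hy, h.plane.card_union_star hz, Finset.card_pair hpq.ne,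
      Finset.card_pair hzq.ne]

namespace HasOpenScaffold

variable {n h t k : ℕ}

theorem hasScaffold (hopen : HasOpenScaffold n h t k) : HasScaffold (n + 2) (h + 1) (t + 3) k := by
  obtain ⟨S, A, H, T, M, p, q, hM, hpq, hH, hp, hq⟩ := hopen
  obtain ⟨u, hu, u', hu', H', T', -, -, h', hHH', hcardH, hcardT⟩ :=
    hM.exists_insert_pair hH (hM.orient_pos_of_mem_free hpq hp hq)
      (Eventually.of_forall fun _ => trivial)
  refine ⟨_, _, H', T', M, h', hM.matching_subset.trans hHH', ?_, ?_, ?_, ?_, hM.card_matching⟩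
  · rw [Finset.insert_sdiff_insert, Finset.sdiff_insert_of_notMem hu', Finset.insert_sdiff_insert,
      Finset.sdiff_insert_of_notMem hu]
    exact hM.isPerfectMatchingOn
  · rw [Finset.card_insert_of_notMem hu', Finset.card_insert_of_notMem hu, hM.card_points]
  · rw [hcardH, hM.card_frame]
  · rw [hcardT, hM.card_edges]

theorem succ (hopen : HasOpenScaffold n h t k) :
    HasOpenScaffold (n + 10) (h + 8) (t + 16) (k + 1) := by
  obtain ⟨S, A, H, T, M, p, q, hM, hpq, hH, hp, hq⟩ := hopen
  obtain ⟨z, hz, S₁, A₁, H₁, T₁, h₁, hfree₁, hzq, -, hzqH, hHH₁, hS₁, hH₁, hT₁⟩ :=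
    hM.exists_insert_five hpq hH hp hq
  have hzW : z ∈ S₁ \ A₁ := hfree₁ ▸ Finset.mem_insert_self z _
  have hqW : q ∈ S₁ \ A₁ :=
    hfree₁ ▸ Finset.mem_insert_of_mem (Finset.mem_sdiff.2 ⟨hpq.right_mem, hq⟩)
  obtain ⟨y, hy, S₂, A₂, H₂, T₂, h₂, hfree₂, hyq, hyzH, hyqH, hHH₂, hS₂, hH₂, hT₂⟩ :=
    h₁.exists_insert_five hzq hzqH (Finset.mem_sdiff.1 hzW).2 (Finset.mem_sdiff.1 hqW).2
  have hyW : y ∈ S₂ \ A₂ := hfree₂ ▸ Finset.mem_insert_self y _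
  have hqW' : q ∈ S₂ \ A₂ := hfree₂ ▸ Finset.mem_insert_of_mem hqW
  have hyW₁ : y ∉ S₁ \ A₁ := fun hyW₁ => hy (Finset.mem_sdiff.1 hyW₁).1
  have hzS : z ∉ S \ A := fun hzS => hz (Finset.mem_sdiff.1 hzS).1
  rw [hfree₁] at hyW₁ hfree₂
  have hyzM : s(y, z) ∉ M := fun hyzM =>
    hyW₁ (Finset.mem_insert_of_mem (hM.isPerfectMatchingOn.mem y z hyzM))
  refine ⟨S₂, A₂, H₂, T₂, insert s(y, z) M, y, q, ⟨h₂, ?_, ?_, ?_, ?_, ?_, ?_⟩, hyq, hyqH,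
    (Finset.mem_sdiff.1 hyW).2, (Finset.mem_sdiff.1 hqW').2⟩
  · exact Finset.insert_subset hyzH ((hM.matching_subset.trans hHH₁).trans hHH₂)
  · rw [hfree₂]
    exact hM.isPerfectMatchingOn.insert hyW₁ hzS
  · rw [hS₂, hS₁, hM.card_points]
  · rw [hH₂, hH₁, hM.card_frame]
  · rw [hT₂, hT₁, hM.card_edges]
  · rw [Finset.card_insert_of_notMem hyzM, hM.card_matching]

end HasOpenScaffold

theorem hasOpenScaffold (i k : ℕ) :
    HasOpenScaffold (4 + i + 10 * k) (2 + 2 * i + 8 * k) (5 + 2 * i + 16 * k) (k + 1) := by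
  induction k with
  | zero => convert (hasSaturatedGraph_polygon i).hasOpenScaffold using 1 <;> omega
  | succ k ih => exact ih.succ

end MatchedScaffolds

section DrawnGraphs

variable {V : Type*} {S A : Finset (ℝ × ℝ)} {E H T M : Finset (Sym2 (ℝ × ℝ))}
  {a b c d : ℝ × ℝ} {n h t k m : ℕ}

theorem IsPlaneGraph.segment_inter_segment_subset (hT : IsPlaneGraph S T) (hab : s(a, b) ∈ T)
    (hcd : s(c, d) ∈ T) (hne : s(a, b) ≠ s(c, d)) :
    segment ℝ a b ∩ segment ℝ c d ⊆ {a, b} ∩ {c, d} := by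
  have hshare {a b d : ℝ × ℝ} (hab : s(a, b) ∈ T) (had : s(a, d) ∈ T) (hne : s(a, b) ≠ s(a, d)) :
      segment ℝ a b ∩ segment ℝ a d ⊆ {a} :=
    _root_.segment_inter_segment_subset <| hT.orient_ne a (hT.mem _ _ hab) b (hT.mem_right hab)
      d (hT.mem_right had) (hT.ne _ _ hab) (hT.ne _ _ had) (fun hbd => hne (hbd ▸ rfl))
  rintro x ⟨hx, hx'⟩
  rcases eq_or_ne a c with rfl | hac
  · simp [Set.mem_singleton_iff.1 (hshare hab hcd hne ⟨hx, hx'⟩)]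
  rcases eq_or_ne b d with rfl | hbd
  · rw [Sym2.eq_swap (a := a)] at hab hne
    rw [Sym2.eq_swap (a := c)] at hcd hne
    rw [segment_symm] at hx hx'
    simp [Set.mem_singleton_iff.1 (hshare hab hcd hne ⟨hx, hx'⟩)]
  rcases eq_or_ne a d with rfl | had
  · rw [Sym2.eq_swap (a := c)] at hcd hne
    rw [segment_symm] at hx'
    simp [Set.mem_singleton_iff.1 (hshare hab hcd hne ⟨hx, hx'⟩)]
  rcases eq_or_ne b c with rfl | hbc
  · rw [Sym2.eq_swap] at hab hne
    rw [segment_symm] at hx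
    simp [Set.mem_singleton_iff.1 (hshare hab hcd hne ⟨hx, hx'⟩)]
  exact absurd hx' (Set.disjoint_left.1 (hT.noncrossing _ _ _ _ hab hcd hac had hbc hbd) hx)

/-- The graph on `V` that becomes the set of edges `E` when its vertices are placed at the points
of `S` by `e`. -/
def drawnGraph (e : V ≃ S) (E : Finset (Sym2 (ℝ × ℝ))) : SimpleGraph V :=
  SimpleGraph.fromEdgeSet (Sym2.map (fun v => (e v : ℝ × ℝ)) ⁻¹' E)

theorem drawnGraph_sup (e : V ≃ S) (E F : Finset (Sym2 (ℝ × ℝ))) :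
    drawnGraph e E ⊔ drawnGraph e F = drawnGraph e (E ∪ F) := by
  simp [drawnGraph]

theorem drawnGraph_mono (e : V ≃ S) (hET : E ⊆ T) : drawnGraph e E ≤ drawnGraph e T :=
  SimpleGraph.fromEdgeSet_mono (Set.preimage_mono (Finset.coe_subset.2 hET))

namespace IsPlaneGraph

theorem drawnGraph_adj (hE : IsPlaneGraph S E) (e : V ≃ S) {a b : V} :
    (drawnGraph e E).Adj a b ↔ s((e a : ℝ × ℝ), (e b : ℝ × ℝ)) ∈ E := by
  simp only [drawnGraph, SimpleGraph.fromEdgeSet_adj, Set.mem_preimage, Sym2.map_mk,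
    Finset.mem_coe, and_iff_left_iff_imp]
  exact fun hab h => hE.ne _ _ hab (h ▸ rfl)

theorem isNoncrossing_drawnGraph (hE : IsPlaneGraph S E) (e : V ≃ S) :
    IsNoncrossing (drawnGraph e E) (fun v => (e v : ℝ × ℝ)) := by
  have hinj : Function.Injective fun v => (e v : ℝ × ℝ) := Subtype.val_injective.comp e.injective
  intro a b c d hab hcd hne
  rw [hE.drawnGraph_adj] at hab hcd
  rw [Set.image_inter hinj, Set.image_pair, Set.image_pair]
  exact hE.segment_inter_segment_subset hab hcd fun h => hne (Sym2.map.injective hinj h)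

theorem ncard_edgeSet_drawnGraph (hE : IsPlaneGraph S E) (e : V ≃ S) :
    (drawnGraph e E).edgeSet.ncard = E.card := by
  have hinj : Function.Injective fun v => (e v : ℝ × ℝ) := Subtype.val_injective.comp e.injective
  rw [← Set.ncard_image_of_injective _ (Sym2.map.injective hinj), ← Set.ncard_coe_finset]
  congr 1
  ext f
  constructor
  · rintro ⟨f, hf, rfl⟩
    induction f with
    | _ a b => exact (hE.drawnGraph_adj e).1 hf
  · induction f with
    | _ x y =>
      intro hxy
      obtain ⟨a, ha⟩ := e.surjective ⟨x, hE.mem _ _ hxy⟩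
      obtain ⟨b, hb⟩ := e.surjective ⟨y, hE.mem_right hxy⟩
      exact ⟨s(a, b), (hE.drawnGraph_adj e).2 (by simpa [ha, hb] using hxy), by simp [ha, hb]⟩

/-- The abstract geometric graph drawn as `E` when its vertices are placed at the points of `S`
by `e`. -/
def toGeometricGraph (hE : IsPlaneGraph S E) (e : V ≃ S) : GeometricGraph V where
  graph := drawnGraph e E
  pos v := e v
  pos_injective := Subtype.val_injective.comp e.injective
  general_position u v w huv huw hvw := not_collinear_of_orient_ne_zero <|
    hE.orient_ne _ (e u).2 _ (e v).2 _ (e w).2 (by simpa) (by simpa) (by simpa)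
  noncrossing := hE.isNoncrossing_drawnGraph e

end IsPlaneGraph

theorem IsNoncrossing.not_blocked {e : V ≃ S} {K : SimpleGraph V} {u v : V}
    (hK : IsNoncrossing K fun v => (e v : ℝ × ℝ)) (hH : IsPlaneGraph S H)
    (hHK : drawnGraph e H ≤ K) (huv : K.Adj u v) : ¬ Blocked H (e u) (e v) := by
  rintro ⟨c, d, hcd, huc, hud, hvc, hvd, x, hx⟩
  obtain ⟨c, rfl⟩ : ∃ c', (e c' : ℝ × ℝ) = c :=
    ⟨e.symm ⟨c, hH.mem _ _ hcd⟩, by simp⟩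
  obtain ⟨d, rfl⟩ : ∃ d', (e d' : ℝ × ℝ) = d :=
    ⟨e.symm ⟨d, hH.mem_right hcd⟩, by simp⟩
  simp only [ne_eq, Subtype.val_inj, e.apply_eq_iff_eq] at huc hud hvc hvd
  have hne : s(u, v) ≠ s(c, d) := by simp [huc, hud]
  obtain ⟨y, ⟨hy, hy'⟩, -⟩ := hK u v c d huv (hHK ((hH.drawnGraph_adj e).2 hcd)) hne hx
  rcases hy with rfl | rfl <;> rcases hy' with hy' | hy' <;> contradiction

namespace IsMatchedScaffold

theorem isPlaneGraph_matching (hM : IsMatchedScaffold S A H T M n h t k) : IsPlaneGraph S M :=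
  hM.plane_frame.mono hM.matching_subset

theorem isCompatibleMatching (hM : IsMatchedScaffold S A H T M n h t k) (hE : IsPlaneGraph S E)
    (hET : E ⊆ T) (hEM : Disjoint E M) (e : V ≃ S) :
    (hE.toGeometricGraph e).IsCompatibleMatching (drawnGraph e M) where
  matching a b c hab hac := by
    rw [hM.isPlaneGraph_matching.drawnGraph_adj] at hab hac
    have := (hM.isPerfectMatchingOn.existsUnique _ (hM.isPerfectMatchingOn.mem _ _ hab)).unique
      hab hac
    simpa using this
  disjoint := by
    refine SimpleGraph.disjoint_left.2 fun a b hab hab' => ?_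
    exact Finset.disjoint_left.1 hEM ((hE.drawnGraph_adj e).1 hab)
      ((hM.isPlaneGraph_matching.drawnGraph_adj e).1 hab')
  noncrossing := by
    change IsNoncrossing (drawnGraph e E ⊔ drawnGraph e M) _
    rw [drawnGraph_sup]
    exact (hM.plane.mono (Finset.union_subset hET
      (hM.matching_subset.trans hM.frame_subset))).isNoncrossing_drawnGraph e

theorem isMaximalCompatibleMatching (hM : IsMatchedScaffold S A H T M n h t k)
    (hE : IsPlaneGraph S E) (hET : E ⊆ T) (hEM : Disjoint E M) (hHE : H ⊆ E ∪ M) (e : V ≃ S) :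
    (hE.toGeometricGraph e).IsMaximalCompatibleMatching (drawnGraph e M) := by
  refine ⟨hM.isCompatibleMatching hE hET hEM e, fun M' hM' hMM' => ?_⟩
  have hmatched : ∀ u v, M'.Adj u v → (e u : ℝ × ℝ) ∉ A → (drawnGraph e M).Adj u v := by
    intro u v huv hu
    obtain ⟨x, hux, -⟩ := hM.isPerfectMatchingOn.existsUnique _ (Finset.mem_sdiff.2 ⟨(e u).2, hu⟩)
    obtain ⟨w, hw⟩ := e.surjective ⟨x, hM.isPlaneGraph_matching.mem_right hux⟩
    have huw : (drawnGraph e M).Adj u w :=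
      (hM.isPlaneGraph_matching.drawnGraph_adj e).2 (by simpa [hw] using hux)
    rwa [hM'.matching u v w huv (hMM' huw)]
  have hH : drawnGraph e H ≤ drawnGraph e E ⊔ M' :=
    ((drawnGraph_mono e hHE).trans (drawnGraph_sup e E M).ge).trans (sup_le_sup_left hMM' _)
  intro u v huv
  by_cases hu : (e u : ℝ × ℝ) ∈ A
  swap
  · exact hmatched u v huv hu
  by_cases hv : (e v : ℝ × ℝ) ∈ A
  swap
  · exact (hmatched v u huv.symm hv).symm
  rcases hM.saturated hu hv (by simpa using huv.ne) with huvH | hblocked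
  · rcases Finset.mem_union.1 (hHE huvH) with huvE | huvM
    · exact absurd huv (SimpleGraph.disjoint_left.1 hM'.disjoint u v
        ((hE.drawnGraph_adj e).2 huvE))
    · exact (hM.isPlaneGraph_matching.drawnGraph_adj e).2 huvM
  · exact absurd hblocked (hM'.noncrossing.not_blocked hM.plane_frame hH (Or.inr huv))

end IsMatchedScaffold

/-- The existence of a geometric graph with `n` vertices and `m` edges that has a maximal compatible
matching of size `k`. -/
def HasMaximalMatching (n m k : ℕ) : Prop :=
  ∃ G : GeometricGraph (Fin n), G.numEdges = m ∧
    ∃ M : SimpleGraph (Fin n), G.IsMaximalCompatibleMatching M ∧ M.edgeSet.ncard = k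

theorem HasScaffold.hasMaximalMatching (hs : HasScaffold n h t k) (hhm : h ≤ m + k)
    (hmt : m + k ≤ t) : HasMaximalMatching n m k := by
  obtain ⟨S, A, H, T, M, hM⟩ := hs
  obtain ⟨E, hHE, hETM, hcard⟩ : ∃ E, H \ M ⊆ E ∧ E ⊆ T \ M ∧ E.card = m := by
    refine Finset.exists_subsuperset_card_eq (Finset.sdiff_subset_sdiff hM.frame_subset subset_rfl)
      ?_ ?_
    · rw [Finset.card_sdiff_of_subset hM.matching_subset, hM.card_frame, hM.card_matching]
      omega
    · rw [Finset.card_sdiff_of_subset (hM.matching_subset.trans hM.frame_subset), hM.card_edges,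
        hM.card_matching]
      omega
  obtain ⟨hET, hEM⟩ := Finset.subset_sdiff.1 hETM
  have hE := hM.plane.mono hET
  have e : Fin n ≃ S := (S.equivFinOfCardEq hM.card_points).symm
  exact ⟨hE.toGeometricGraph e, (hE.ncard_edgeSet_drawnGraph e).trans hcard, drawnGraph e M,
    hM.isMaximalCompatibleMatching hE hET hEM (sdiff_le_iff'.1 hHE) e,
    (hM.isPlaneGraph_matching.ncard_edgeSet_drawnGraph e).trans hM.card_matching⟩

end DrawnGraphs

section Density

variable {n m k : ℕ} {d : ℝ}

theorem hasMaximalMatching_of_le (hk : 1 ≤ k) (hkn : 10 * k ≤ n + 4) (hm : 2 * n + 3 ≤ m + 13 * k)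
    (hmn : m + 5 * k ≤ 2 * n) : HasMaximalMatching n m k := by
  obtain ⟨k, rfl⟩ : ∃ k', k = k' + 1 := ⟨k - 1, by omega⟩
  obtain ⟨i, rfl⟩ : ∃ i, n = 4 + i + 10 * k + 2 := ⟨n - (10 * k + 6), by omega⟩
  exact (hasOpenScaffold i k).hasScaffold.hasMaximalMatching (by omega) (by omega)

theorem hasMaximalMatching_one (hm : 2 * n ≤ m + 4) (hmn : m + 7 ≤ 3 * n) :
    HasMaximalMatching n m 1 := by
  obtain ⟨j, hj⟩ : ∃ j, m + 4 = j + 2 * n := ⟨m + 4 - 2 * n, by omega⟩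
  obtain ⟨i, rfl⟩ : ∃ i, n = 3 + j + i := ⟨n - (3 + j), by omega⟩
  exact (hasSaturatedGraph_triangulation i j).hasScaffold.hasMaximalMatching (by omega) (by omega)

theorem exists_hasMaximalMatching (h : 7 * n + 95 ≤ 10 * m) (hm : m ≤ 2 * n + 2)
    (hmn : m + 7 ≤ 3 * n) :
    ∃ k, 2 * n + 3 ≤ m + 13 * k ∧ m + 13 * k ≤ 2 * n + 15 ∧ HasMaximalMatching n m k := by
  obtain ⟨k, hk⟩ : ∃ k, k = (2 * n + 15 - m) / 13 := ⟨_, rfl⟩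
  refine ⟨k, by omega, by omega, ?_⟩
  by_cases hone : 2 * n ≤ m + 4
  · obtain rfl : k = 1 := by omega
    exact hasMaximalMatching_one hone hmn
  · exact hasMaximalMatching_of_le (by omega) (by omega) (by omega) (by omega)

theorem exists_isMaximalCompatibleMatching_ncard_eq_ceil
    (h : (7 * (n : ℚ) + 95) / 10 ≤ m) (hm : m ≤ 2 * n + 2) (hmn : (m : ℤ) ≤ 3 * n - 7) :
    ∃ G : GeometricGraph (Fin n), G.numEdges = m ∧
      ∃ M : SimpleGraph (Fin n), G.IsMaximalCompatibleMatching M ∧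
        (M.edgeSet.ncard : ℤ) = ⌈(2 * (n : ℚ) - m + 3) / 13⌉ := by
  rw [div_le_iff₀' (by norm_num)] at h
  obtain ⟨k, hk, hk', G, hG, M, hM, hMk⟩ :=
    exists_hasMaximalMatching (by exact_mod_cast h) hm (by omega)
  refine ⟨G, hG, M, hM, (Int.ceil_eq_iff.2 ?_).symm⟩
  replace hk : (2 * n + 3 : ℚ) ≤ m + 13 * k := by exact_mod_cast hk
  replace hk' : (m + 13 * k : ℚ) ≤ 2 * n + 15 := by exact_mod_cast hk'
  rw [hMk, Int.cast_natCast]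
  constructor <;> linarith

theorem HasMaximalMatching.iInf_family_le (h : HasMaximalMatching n m k) (hm : (m : ℝ) ≤ d * n) :
    ⨅ G ∈ GeometricGraph.family d n, ((G.mm / n : ℝ) : EReal) ≤ ((k / n : ℝ) : EReal) := by
  obtain ⟨G, rfl, M, hM, rfl⟩ := h
  have hmm : G.mm ≤ M.edgeSet.ncard := Nat.sInf_le ⟨M, hM, rfl⟩
  refine (iInf₂_le G hm).trans (EReal.coe_le_coe_iff.2 ?_)
  gcongr

theorem eventually_iInf_family_le (hd : 7 / 10 < d) (hd' : d < 2) :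
    ∀ᶠ n : ℕ in atTop, ⨅ G ∈ GeometricGraph.family d n, ((G.mm / n : ℝ) : EReal) ≤
      (((2 - d) / 13 + 2 / n : ℝ) : EReal) := by
  have hlarge : ∀ᶠ n : ℕ in atTop, 21 / 2 ≤ (d - 7 / 10) * n :=
    (tendsto_natCast_atTop_atTop.const_mul_atTop (by linarith)).eventually_ge_atTop _
  filter_upwards [hlarge, eventually_ge_atTop 7] with n hn hn7
  have hn0 : (0 : ℝ) < n := by exact_mod_cast (by omega : 0 < n)
  have hfloor : (⌊d * n⌋₊ : ℝ) ≤ d * n := Nat.floor_le (mul_nonneg (by linarith) hn0.le)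
  have hfloor' : d * n < ⌊d * n⌋₊ + 1 := Nat.lt_floor_add_one _
  have hdn : d * n ≤ 2 * n := by gcongr
  have hm : ⌊d * n⌋₊ ≤ 2 * n := by exact_mod_cast hfloor.trans hdn
  have hm' : 7 * n + 95 ≤ 10 * ⌊d * n⌋₊ := by
    have : (7 * n + 95 : ℝ) ≤ 10 * ⌊d * n⌋₊ := by linarith
    exact_mod_cast this
  obtain ⟨k, -, hk, hM⟩ := exists_hasMaximalMatching hm' (by omega) (by omega)
  refine (hM.iInf_family_le hfloor).trans (EReal.coe_le_coe_iff.2 ?_)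
  replace hk : (⌊d * n⌋₊ + 13 * k : ℝ) ≤ 2 * n + 15 := by exact_mod_cast hk
  rw [div_le_iff₀ hn0, add_mul, div_mul_cancel₀ _ hn0.ne']
  linarith

theorem mmDensity_le (hd : 7 / 10 < d) (hd' : d < 2) :
    GeometricGraph.mmDensity d ≤ (((2 - d) / 13 : ℝ) : EReal) := by
  have hlim : Tendsto (fun n : ℕ => (((2 - d) / 13 + 2 / n : ℝ) : EReal)) atTop
      (𝓝 (((2 - d) / 13 : ℝ) : EReal)) := by
    refine (continuous_coe_real_ereal.tendsto _).comp ?_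
    simpa using (tendsto_const_nhds (x := (2 - d) / 13)).add
      (tendsto_const_div_atTop_nhds_zero_nat 2)
  exact (liminf_le_liminf (eventually_iInf_family_le hd hd')).trans hlim.liminf_eq.le

end Density

theorem lemma2 :
    (∀ n m : ℕ, 5 ≤ n → (7 * (n : ℚ) + 95) / 10 ≤ (m : ℚ) → m ≤ 2 * n + 2 →
      (m : ℤ) ≤ 3 * (n : ℤ) - 7 →
      ∃ G : GeometricGraph (Fin n), G.numEdges = m ∧
        ∃ M : SimpleGraph (Fin n), G.IsMaximalCompatibleMatching M ∧
          (M.edgeSet.ncard : ℤ) = ⌈(2 * (n : ℚ) - (m : ℚ) + 3) / 13⌉) ∧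
    (∀ d : ℝ, 7 / 10 < d → d < 2 →
      GeometricGraph.mmDensity d ≤ (((2 - d) / 13 : ℝ) : EReal)) :=
  ⟨fun _ _ _ h hm hmn => exists_isMaximalCompatibleMatching_ncard_eq_ceil h hm hmn,
    fun _ hd hd' => mmDensity_le hd hd'⟩
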